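/- Let $d, k, M$ be natural numbers with $1 \le d \le k$. Let $V$ be a set of vertices whose codes are independent random vectors, each uniformly distributed on the unit sphere $\mathbb{S}^{d-1} \subset \mathbb{R}^d$; write each vertex and its code by the same letter. Consider a directed graph with a signal edge $(u,v)$ and $k$ other edges $(q_1,r_1),\dots,(q_k,r_k)$, where the $2k+2$ vertices $u,v,q_1,\dots,q_k,r_1,\dots,r_k \in V$ are all distinct, and its embedding $$G = u v^T + \sum_{i=1}^k q_i r_i^T \in \mathbb{R}^{d\times d}.$$ Let $(a_1,b_1),\dots,(a_M,b_M)$ be $M$ spurious edges, that is, pairs of vertices of $V$ none of which is a vertex of the graph. Let $T = u^T G v$ be the query score of the signal edge, let $F_j = a_j^T G b_j$ be the query scores of the spurious edges, and let $A$ be the event that $T > F_j$ for every $j = 1,\dots,M$. Then $$P(A) \ge 1 - M e^{-C d^2/k},$$ where $C > 0$ is a universal constant (independent of $d$, $k$, $M$ and of the vertices and edges). -/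

import Mathlib

open MeasureTheory ProbabilityTheory

noncomputable section

/-- The unit sphere `S^{d-1}` of Euclidean space `ℝ^d`. -/
abbrev UnitSphere (d : ℕ) : Type := Metric.sphere (0 : EuclideanSpace ℝ (Fin d)) 1

/-- The uniform distribution on `S^{d-1}`: the surface measure, normalized to total mass `1`. -/
def uniformSphere (d : ℕ) : Measure (UnitSphere d) :=
  ((volume : Measure (EuclideanSpace ℝ (Fin d))).toSphere Set.univ)⁻¹ •
    (volume : Measure (EuclideanSpace ℝ (Fin d))).toSphere

/-- A spherical code for the vertex set `V`: the vertices get independent random unit vectors,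
each uniformly distributed on the sphere. -/
structure IsSphericalCode {V Ω : Type*} [MeasurableSpace Ω] {d : ℕ}
    (x : V → Ω → UnitSphere d) (P : Measure Ω) : Prop where
  hasLaw : ∀ w, HasLaw (x w) (uniformSphere d) P
  indep : iIndepFun x P

/-- The outer product `s tᵀ` which embeds a directed edge with vertex codes `s`, `t`. -/
def edgeEmbedding {d : ℕ} (s t : UnitSphere d) : Matrix (Fin d) (Fin d) ℝ :=
  Matrix.vecMulVec s.1.ofLp t.1.ofLp

/-- The embedding `u vᵀ + ∑ i, q i (r i)ᵀ` of the directed graph with edges `(u, v)` and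
`(q i, r i)`, with respect to the vertex codes `c`. -/
def graphEmbedding {V : Type*} {d k : ℕ} (c : V → UnitSphere d) (u v : V) (q r : Fin k → V) :
    Matrix (Fin d) (Fin d) ℝ :=
  edgeEmbedding (c u) (c v) + ∑ i, edgeEmbedding (c (q i)) (c (r i))

/-- The edge query score `sᵀ G t`. -/
def queryScore {d : ℕ} (G : Matrix (Fin d) (Fin d) ℝ) (s t : UnitSphere d) : ℝ :=
  s.1.ofLp ⬝ᵥ G.mulVec t.1.ofLp

/-- The list of the `2k + 2` endpoints of the edges `(u, v)` and `(q i, r i)`. -/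
def graphVertices {V : Type*} {k : ℕ} (u v : V) (q r : Fin k → V) :
    Fin 2 ⊕ (Fin k ⊕ Fin k) → V :=
  Sum.elim ![u, v] (Sum.elim q r)

/-- The event that the query score of the signal edge `(u, v)` exceeds the query score of every
spurious edge `(a j, b j)`. -/
def correctRecovery {V Ω : Type*} {d k M : ℕ} (x : V → Ω → UnitSphere d) (u v : V)
    (q r : Fin k → V) (a b : Fin M → V) : Set Ω :=
  {ω | ∀ j, queryScore (graphEmbedding (fun w => x w ω) u v q r) (x (a j) ω) (x (b j) ω) <
    queryScore (graphEmbedding (fun w => x w ω) u v q r) (x u ω) (x v ω)}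

end

/-! Write `S s t = ∑ i, ⟨s, q i⟩⟨r i, t⟩`. Then `T = 1 + S u v` and `F = ⟨a, u⟩⟨v, b⟩ + S a b`, so a
spurious edge wins only if `|⟨a, u⟩|`, `-S u v` or `S a b` is at least a fixed constant. By a union
bound over the spurious edges it suffices to bound the probability of this for one of them.

For `d ≥ 2`, comparison with a Gaussian vector gives `E exp (l⟨s, q⟩) ≤ exp (l²/d)`
(`lintegral_exp_inner_le`). Applying this to `r` with `q` fixed leaves the exponential of a square,
which a Gaussian integral linearizes; each summand of `S` then has moment generating function at
most `exp (4l²/d²)` for `8l² ≤ d²`. Independence multiplies these `k` bounds, and Chernoff with `l`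
of order `d²/k`, admissible because `d ≤ k`, gives `4 exp (-d²/(256k))`.

The factor `4` must go, since the claim has constant `1`. Sign symmetries of the codes show that a
spurious edge wins with probability at most `3/4`. This settles small `d²/k`, including `d = 1`; for
larger `d²/k` a smaller rate absorbs the `4`. -/

/-! ### Gamma function and radial Gaussian integrals -/

/-- Log-convexity of Gamma at `d/2`, the midpoint of `(d-1)/2` and `(d+1)/2`. It bounds below the
mean radius of a Gaussian vector; `d ≥ 2` keeps `(d-1)/2` positive. -/
lemma sq_Gamma_half_mul_le {d : ℕ} (hd : 2 ≤ d) :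
    Real.Gamma (d / 2) ^ 2 * (((d : ℝ) - 1) / 2) ≤ Real.Gamma ((d + 1) / 2) ^ 2 := by
  have hd' : (2 : ℝ) ≤ d := by exact_mod_cast hd
  have h := Real.Gamma_mul_add_mul_le_rpow_Gamma_mul_rpow_Gamma (s := ((d : ℝ) - 1) / 2)
    (t := ((d : ℝ) + 1) / 2) (a := 1 / 2) (b := 1 / 2) (by linarith) (by linarith)
    (by norm_num) (by norm_num) (by norm_num)
  rw [show (1 / 2 : ℝ) * (((d : ℝ) - 1) / 2) + 1 / 2 * (((d : ℝ) + 1) / 2) = d / 2 by ring,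
    ← Real.sqrt_eq_rpow, ← Real.sqrt_eq_rpow] at h
  have h1 : 0 < Real.Gamma (((d : ℝ) - 1) / 2) := Real.Gamma_pos_of_pos (by linarith)
  have h2 : 0 < Real.Gamma (((d : ℝ) + 1) / 2) := Real.Gamma_pos_of_pos (by linarith)
  have h3 : 0 < Real.Gamma ((d : ℝ) / 2) := Real.Gamma_pos_of_pos (by linarith)
  have h4 : Real.Gamma (((d : ℝ) + 1) / 2) = ((d : ℝ) - 1) / 2 * Real.Gamma (((d : ℝ) - 1) / 2) := by
    rw [← Real.Gamma_add_one (by linarith)]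
    congr 1
    ring
  have h5 : Real.Gamma ((d : ℝ) / 2) ^ 2 ≤
      Real.Gamma (((d : ℝ) - 1) / 2) * Real.Gamma (((d : ℝ) + 1) / 2) := by
    calc Real.Gamma ((d : ℝ) / 2) ^ 2
        ≤ (√(Real.Gamma (((d : ℝ) - 1) / 2)) * √(Real.Gamma (((d : ℝ) + 1) / 2))) ^ 2 := by gcongr
      _ = _ := by rw [mul_pow, Real.sq_sqrt h1.le, Real.sq_sqrt h2.le]
  have h6 := mul_le_mul_of_nonneg_right h5 (show 0 ≤ ((d : ℝ) - 1) / 2 by linarith)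
  nlinarith [h6, h4]

lemma integral_Ioi_pow_mul_exp_neg_sq (n : ℕ) :
    ∫ r in Set.Ioi (0 : ℝ), r ^ n * Real.exp (-r ^ 2) = Real.Gamma ((n + 1) / 2) / 2 := by
  have h := integral_rpow_mul_exp_neg_rpow (p := 2) (q := n) (by norm_num)
    (by linarith [n.cast_nonneg (α := ℝ)])
  simp only [Real.rpow_natCast, Real.rpow_ofNat] at h
  rw [h]; ring

lemma integrableOn_Ioi_pow_mul_exp_neg_sq (n : ℕ) :
    IntegrableOn (fun r : ℝ => r ^ n * Real.exp (-r ^ 2)) (Set.Ioi 0) := by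
  have h := integrableOn_rpow_mul_exp_neg_mul_sq (b := 1) one_pos (s := n)
    (by linarith [n.cast_nonneg (α := ℝ)])
  simpa using h

/-! ### Sub-Gaussian coordinates on the sphere -/

/-- Integration in polar coordinates. -/
lemma lintegral_eq_lintegral_toSphere {d : ℕ} (hd : 1 ≤ d)
    {f : EuclideanSpace ℝ (Fin d) → ENNReal} (hf : Measurable f) :
    ∫⁻ x, f x = ∫⁻ q, (∫⁻ r in Set.Ioi (0 : ℝ), ENNReal.ofReal (r ^ (d - 1)) * f (r • q.1))
      ∂(volume : Measure (EuclideanSpace ℝ (Fin d))).toSphere := by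
  set μ : Measure (EuclideanSpace ℝ (Fin d)) := volume
  have : NeZero d := ⟨by omega⟩
  have hmp := μ.measurePreserving_homeomorphUnitSphereProd
  have hg : Measurable fun p : UnitSphere d × Set.Ioi (0 : ℝ) => f (p.2.1 • p.1.1) :=
    hf.comp (by fun_prop)
  calc ∫⁻ x, f x ∂μ = ∫⁻ x in {0}ᶜ, f x ∂μ := by rw [restrict_compl_singleton]
    _ = ∫⁻ x : ({(0)}ᶜ : Set (EuclideanSpace ℝ (Fin d))), f x.1 ∂(μ.comap (↑)) :=
      (lintegral_subtype_comap (measurableSet_singleton _).compl f).symm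
    _ = ∫⁻ p, f (p.2.1 • p.1.1) ∂(μ.toSphere.prod (.volumeIoiPow (Module.finrank ℝ (EuclideanSpace ℝ (Fin d)) - 1))) := by
      rw [← hmp.lintegral_comp hg]
      refine lintegral_congr fun x => ?_
      have := congrArg Subtype.val ((homeomorphUnitSphereProd (EuclideanSpace ℝ (Fin d))).symm_apply_apply x)
      rw [homeomorphUnitSphereProd_symm_apply_coe] at this
      rw [this]
    _ = _ := by
      rw [lintegral_prod _ hg.aemeasurable, finrank_euclideanSpace_fin]
      refine lintegral_congr fun q => ?_
      have hq : Measurable fun r : ℝ => f (r • q.1) := hf.comp (by fun_prop)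
      rw [Measure.volumeIoiPow]
      refine (lintegral_withDensity_eq_lintegral_mul _ (by fun_prop)
        (hq.comp measurable_subtype_coe)).trans ?_
      exact lintegral_subtype_comap measurableSet_Ioi
        (fun r : ℝ => ENNReal.ofReal (r ^ (d - 1)) * f (r • q.1))

lemma ofReal_integral_le_lintegral_ofReal {α : Type*} [MeasurableSpace α] {μ : Measure α}
    {f : α → ℝ} (hf : Integrable f μ) :
    ENNReal.ofReal (∫ x, f x ∂μ) ≤ ∫⁻ x, ENNReal.ofReal (f x) ∂μ := by
  rw [integral_eq_lintegral_pos_part_sub_lintegral_neg_part hf]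
  refine (ENNReal.ofReal_le_ofReal (sub_le_self _ ENNReal.toReal_nonneg)).trans ?_
  exact ENNReal.ofReal_toReal_le

/-- Jensen's inequality for the radial part of a Gaussian vector. -/
lemma ofReal_exp_mul_Gamma_le {d : ℕ} (hd : 1 ≤ d) (y : ℝ) :
    ENNReal.ofReal (Real.exp (Real.Gamma ((d + 1) / 2) / Real.Gamma (d / 2) * y)) *
        ENNReal.ofReal (Real.Gamma (d / 2) / 2) ≤
      ∫⁻ r in Set.Ioi (0 : ℝ), ENNReal.ofReal (r ^ (d - 1)) *
        ENNReal.ofReal (Real.exp (r * y - r ^ 2)) := by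
  have hd' : (1 : ℝ) ≤ d := by exact_mod_cast hd
  have h3 : 0 < Real.Gamma ((d : ℝ) / 2) := Real.Gamma_pos_of_pos (by linarith)
  set m := Real.Gamma ((d + 1) / 2) / Real.Gamma (d / 2) with hm
  have e1 := integral_Ioi_pow_mul_exp_neg_sq (d - 1)
  have e2 := integral_Ioi_pow_mul_exp_neg_sq d
  rw [Nat.cast_sub hd, Nat.cast_one, sub_add_cancel] at e1
  have i1 := integrableOn_Ioi_pow_mul_exp_neg_sq (d - 1)
  have i2 := integrableOn_Ioi_pow_mul_exp_neg_sq d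
  -- The integrand is the tangent line of `r ↦ exp (r y)` at `m`, times the radial weight. As `m` is
  -- the mean radius, the linear term integrates to zero.
  have key : ∫ r in Set.Ioi (0 : ℝ), (Real.exp (m * y) * (1 - m * y) * (r ^ (d - 1) * Real.exp (-r ^ 2)) +
      Real.exp (m * y) * y * (r ^ d * Real.exp (-r ^ 2))) = Real.exp (m * y) * (Real.Gamma (d / 2) / 2) := by
    rw [integral_add (i1.const_mul _) (i2.const_mul _), integral_const_mul, integral_const_mul, e1, e2]
    have : Real.Gamma ((d + 1) / 2) = m * Real.Gamma (d / 2) := by rw [hm]; field_simp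
    rw [this]; ring
  rw [← ENNReal.ofReal_mul (Real.exp_pos _).le, ← key]
  refine (ofReal_integral_le_lintegral_ofReal ((i1.const_mul _).add (i2.const_mul _))).trans ?_
  refine setLIntegral_mono' measurableSet_Ioi fun r hr => ?_
  have hr0 : 0 < r := hr
  rw [← ENNReal.ofReal_mul (by positivity)]
  refine ENNReal.ofReal_le_ofReal ?_
  have h1 : Real.exp (m * y) * (1 + y * (r - m)) ≤ Real.exp (r * y) := by
    have := Real.add_one_le_exp (y * (r - m))
    calc Real.exp (m * y) * (1 + y * (r - m)) ≤ Real.exp (m * y) * Real.exp (y * (r - m)) := by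
          gcongr; linarith
      _ = _ := by rw [← Real.exp_add]; congr 1; ring
  have h2 : r ^ d = r ^ (d - 1) * r := by rw [← pow_succ, Nat.sub_add_cancel hd]
  simp only [Pi.add_apply]
  rw [h2, sub_eq_add_neg (r * y), Real.exp_add]
  have : 0 < r ^ (d - 1) * Real.exp (-r ^ 2) := by positivity
  nlinarith [mul_le_mul_of_nonneg_right h1 this.le]

instance isProbabilityMeasure_uniformSphere {d : ℕ} [NeZero d] :
    IsProbabilityMeasure (uniformSphere d) := by
  refine ⟨?_⟩
  rw [uniformSphere, Measure.smul_apply, smul_eq_mul]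
  refine ENNReal.inv_mul_cancel ?_ (measure_ne_top _ _)
  rw [Measure.measure_univ_ne_zero]
  exact Measure.toSphere_ne_zero _

/-- A vector with density proportional to `exp (-‖x‖²)` has a uniform direction and an independent
radius of mean `Γ((d+1)/2)/Γ(d/2)`. Jensen in the radius replaces it by its mean, and the Gaussian
moment generating function is explicit. -/
lemma lintegral_exp_inner_le_aux {d : ℕ} (hd : 1 ≤ d) (u : UnitSphere d) (l : ℝ) :
    ∫⁻ q, ENNReal.ofReal (Real.exp (Real.Gamma ((d + 1) / 2) / Real.Gamma (d / 2) *
      (l * inner ℝ u.1 q.1))) ∂uniformSphere d ≤ ENNReal.ofReal (Real.exp (l ^ 2 / 4)) := by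
  set τ := (volume : Measure (EuclideanSpace ℝ (Fin d))).toSphere with hτ
  have : NeZero d := ⟨by omega⟩
  have hd' : (1 : ℝ) ≤ d := by exact_mod_cast hd
  have h3 : 0 < Real.Gamma ((d : ℝ) / 2) := Real.Gamma_pos_of_pos (by linarith)
  set Z := ENNReal.ofReal (Real.Gamma ((d : ℝ) / 2) / 2) with hZ
  have hu : ‖u.1‖ = 1 := by simp
  have hG : ∫⁻ x : EuclideanSpace ℝ (Fin d), ENNReal.ofReal (Real.exp (-‖x‖ ^ 2)) = Z * τ Set.univ := by
    rw [lintegral_eq_lintegral_toSphere hd (by fun_prop), ← lintegral_const]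
    refine lintegral_congr fun q => ?_
    have e1 := integral_Ioi_pow_mul_exp_neg_sq (d - 1)
    rw [Nat.cast_sub hd, Nat.cast_one, sub_add_cancel] at e1
    rw [hZ, ← e1, ofReal_integral_eq_lintegral_ofReal (integrableOn_Ioi_pow_mul_exp_neg_sq (d - 1))]
    · refine setLIntegral_congr_fun measurableSet_Ioi fun r hr => ?_
      have hr0 : 0 < r := hr
      have hq : ‖q.1‖ = 1 := by simp
      simp only [norm_smul, hq, mul_one, Real.norm_eq_abs, sq_abs]
      rw [ENNReal.ofReal_mul (by positivity)]
    · filter_upwards [ae_restrict_mem measurableSet_Ioi] with r hr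
      have hr0 : 0 < r := hr
      simp only [Pi.zero_apply]
      positivity
  have hL : ∫⁻ x : EuclideanSpace ℝ (Fin d), ENNReal.ofReal (Real.exp (l * inner ℝ u.1 x - ‖x‖ ^ 2)) =
      ENNReal.ofReal (Real.exp (l ^ 2 / 4)) * (Z * τ Set.univ) := by
    -- Translation by `(l/2) u` completes the square.
    rw [← hG, ← lintegral_add_right_eq_self _ ((l / 2) • u.1), ← lintegral_const_mul _ (by fun_prop)]
    refine lintegral_congr fun x => ?_
    rw [← ENNReal.ofReal_mul (Real.exp_pos _).le, ← Real.exp_add, norm_add_sq_real, norm_smul, hu,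
      real_inner_smul_right, inner_add_right, real_inner_smul_right, real_inner_self_eq_norm_sq, hu,
      real_inner_comm u.1 x]
    congr 2
    simp only [Real.norm_eq_abs, mul_one, sq_abs]
    ring
  have hle : (∫⁻ q, ENNReal.ofReal (Real.exp (Real.Gamma ((d + 1) / 2) / Real.Gamma (d / 2) *
      (l * inner ℝ u.1 q.1))) ∂τ) * Z ≤ ENNReal.ofReal (Real.exp (l ^ 2 / 4)) * τ Set.univ * Z := by
    rw [← lintegral_mul_const _ (by fun_prop), mul_assoc, mul_comm (τ Set.univ), ← hL,
      lintegral_eq_lintegral_toSphere hd (by fun_prop)]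
    refine lintegral_mono fun q => (ofReal_exp_mul_Gamma_le hd _).trans_eq ?_
    refine setLIntegral_congr_fun measurableSet_Ioi fun r hr => ?_
    have hr0 : 0 < r := hr
    have hq : ‖q.1‖ = 1 := by simp
    simp only [norm_smul, hq, mul_one, Real.norm_eq_abs, sq_abs, real_inner_smul_right]
    congr 3
    ring
  rw [ENNReal.mul_le_mul_iff_left (by simpa [hZ] using h3) ENNReal.ofReal_ne_top] at hle
  rw [uniformSphere, lintegral_smul_measure, smul_eq_mul]
  calc _ ≤ (τ Set.univ)⁻¹ * (ENNReal.ofReal (Real.exp (l ^ 2 / 4)) * τ Set.univ) := by gcongr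
    _ = _ := by
      rw [mul_left_comm, ENNReal.inv_mul_cancel, mul_one]
      · rw [Measure.measure_univ_ne_zero]
        exact Measure.toSphere_ne_zero _
      · exact measure_ne_top _ _

/-- The coordinates of a uniform random unit vector are sub-Gaussian with variance proxy of
order `1 / d`. -/
lemma lintegral_exp_inner_le {d : ℕ} (hd : 2 ≤ d) (u : UnitSphere d) (l : ℝ) :
    ∫⁻ q, ENNReal.ofReal (Real.exp (l * inner ℝ u.1 q.1)) ∂uniformSphere d ≤
      ENNReal.ofReal (Real.exp (l ^ 2 / d)) := by
  have hd' : (2 : ℝ) ≤ d := by exact_mod_cast hd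
  have h3 : 0 < Real.Gamma ((d : ℝ) / 2) := Real.Gamma_pos_of_pos (by linarith)
  have h4 : 0 < Real.Gamma (((d : ℝ) + 1) / 2) := Real.Gamma_pos_of_pos (by linarith)
  have h := sq_Gamma_half_mul_le hd
  set A := Real.Gamma ((d : ℝ) / 2)
  set B := Real.Gamma (((d : ℝ) + 1) / 2)
  -- Rescaling `l` by `A / B` cancels the mean radius; what remains is `(A/B)²/4 ≤ 1/d`, which
  -- follows from `(d-1)/2 ≥ d/4`.
  refine le_trans (le_of_eq ?_) ((lintegral_exp_inner_le_aux (by omega) u (A / B * l)).trans ?_)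
  · refine lintegral_congr fun q => ?_
    change _ = ENNReal.ofReal (Real.exp (B / A * (A / B * l * _)))
    congr 2
    field_simp
  · refine ENNReal.ofReal_le_ofReal (Real.exp_le_exp.2 ?_)
    rw [mul_pow, div_pow, div_mul_eq_mul_div, div_div, div_le_div_iff₀ (by positivity) (by positivity)]
    have : A ^ 2 * d ≤ B ^ 2 * 4 := by nlinarith [sq_nonneg A]
    nlinarith [sq_nonneg l, mul_le_mul_of_nonneg_left this (sq_nonneg l)]

/-! ### Exponential moments of squares and products -/

lemma lintegral_exp_neg_mul_sq {b : ℝ} (hb : 0 < b) :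
    ∫⁻ z : ℝ, ENNReal.ofReal (Real.exp (-b * z ^ 2)) = ENNReal.ofReal √(Real.pi / b) := by
  rw [← integral_gaussian, ofReal_integral_eq_lintegral_ofReal (integrable_exp_neg_mul_sq hb)]
  exact ae_of_all _ fun z => (Real.exp_pos _).le

/-- Linearization of the square in an exponent by a Gaussian integral. -/
lemma lintegral_exp_linear_sub_sq (y : ℝ) :
    ∫⁻ z : ℝ, ENNReal.ofReal (Real.exp (2 * y * z - z ^ 2)) =
      ENNReal.ofReal (Real.exp (y ^ 2)) * ENNReal.ofReal √Real.pi := by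
  have h := lintegral_exp_neg_mul_sq one_pos
  rw [div_one] at h
  rw [← h, ← lintegral_const_mul _ (by fun_prop), ← lintegral_add_right_eq_self _ y]
  refine lintegral_congr fun z => ?_
  rw [← ENNReal.ofReal_mul (Real.exp_pos _).le, ← Real.exp_add]
  congr 2
  ring

/-- Linearize the square by an auxiliary Gaussian variable `z` and swap integrals. The sub-Gaussian
bound contributes `exp (x z²)` with `x = 4m²/d`, leaving a Gaussian integral that evaluates to
`√(π/(1-x))`. -/
lemma lintegral_exp_inner_sq_le {d : ℕ} (hd : 2 ≤ d) (s : UnitSphere d) {m : ℝ}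
    (hm : 8 * m ^ 2 ≤ d) :
    ∫⁻ q, ENNReal.ofReal (Real.exp ((m * inner ℝ s.1 q.1) ^ 2)) ∂uniformSphere d ≤
      ENNReal.ofReal (Real.exp (4 * m ^ 2 / d)) := by
  have : NeZero d := ⟨by omega⟩
  have hd' : (2 : ℝ) ≤ d := by exact_mod_cast hd
  set x := 4 * m ^ 2 / d with hx
  have hx0 : 0 ≤ x := by positivity
  have hx1 : x ≤ 1 / 2 := by rw [hx, div_le_iff₀ (by linarith)]; linarith
  have hpi : 0 < √Real.pi := Real.sqrt_pos.2 Real.pi_pos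
  have key : (∫⁻ q, ENNReal.ofReal (Real.exp ((m * inner ℝ s.1 q.1) ^ 2)) ∂uniformSphere d) *
      ENNReal.ofReal √Real.pi ≤ ENNReal.ofReal (Real.exp x) * ENNReal.ofReal √Real.pi := by
    rw [← lintegral_mul_const _ (by fun_prop)]
    simp_rw [← lintegral_exp_linear_sub_sq]
    rw [lintegral_lintegral_swap (by fun_prop)]
    calc _ ≤ ∫⁻ z : ℝ, ENNReal.ofReal (Real.exp (-(1 - x) * z ^ 2)) := by
          refine lintegral_mono fun z => ?_
          have h : ∀ q : UnitSphere d,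
              ENNReal.ofReal (Real.exp (2 * (m * inner ℝ s.1 q.1) * z - z ^ 2)) =
              ENNReal.ofReal (Real.exp ((2 * m * z) * inner ℝ s.1 q.1)) *
                ENNReal.ofReal (Real.exp (-z ^ 2)) := by
            intro q
            rw [← ENNReal.ofReal_mul (Real.exp_pos _).le, ← Real.exp_add]
            congr 2
            ring
          simp_rw [h]
          rw [lintegral_mul_const _ (by fun_prop)]
          refine (mul_le_mul_left (lintegral_exp_inner_le hd s (2 * m * z)) _).trans_eq ?_
          rw [← ENNReal.ofReal_mul (Real.exp_pos _).le, ← Real.exp_add]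
          congr 2
          rw [hx]
          ring
      _ = ENNReal.ofReal √(Real.pi / (1 - x)) := lintegral_exp_neg_mul_sq (by linarith)
      _ ≤ _ := by
          rw [← ENNReal.ofReal_mul (Real.exp_pos _).le]
          refine ENNReal.ofReal_le_ofReal ?_
          rw [Real.sqrt_le_left (by positivity), mul_pow, Real.sq_sqrt Real.pi_pos.le,
            div_le_iff₀ (by linarith), ← Real.exp_nat_mul]
          have h1 := Real.add_one_le_exp (((2 : ℕ) : ℝ) * x)
          push_cast at h1
          -- The product is `1 + x(1 - 2x)`, so `x ≤ 1/2` is exactly what is needed; this is where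
          -- `8m² ≤ d` enters.
          have h2 : 1 ≤ (2 * x + 1) * (1 - x) := by nlinarith
          have h3 : 1 ≤ Real.exp (2 * x) * (1 - x) :=
            h2.trans (mul_le_mul_of_nonneg_right h1 (by linarith))
          push_cast
          nlinarith [Real.pi_pos]
  exact (ENNReal.mul_le_mul_iff_left (by simpa using Real.pi_pos) ENNReal.ofReal_ne_top).1 key

/-- The moment generating function of a product of coordinates of two independent uniform random
unit vectors. -/
lemma lintegral_exp_inner_mul_inner_le {d : ℕ} (hd : 2 ≤ d) (s t : UnitSphere d) {l : ℝ}
    (hl : 8 * l ^ 2 ≤ (d : ℝ) ^ 2) :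
    ∫⁻ p : UnitSphere d × UnitSphere d,
        ENNReal.ofReal (Real.exp (l * (inner ℝ s.1 p.1.1 * inner ℝ p.2.1 t.1)))
        ∂(uniformSphere d).prod (uniformSphere d) ≤
      ENNReal.ofReal (Real.exp (4 * l ^ 2 / (d : ℝ) ^ 2)) := by
  have : NeZero d := ⟨by omega⟩
  have hd' : (2 : ℝ) ≤ d := by exact_mod_cast hd
  have hsq : (l / √d) ^ 2 = l ^ 2 / d := by rw [div_pow, Real.sq_sqrt (by linarith)]
  rw [lintegral_prod _ (by fun_prop)]
  -- With the first vector fixed, the second is integrated by the sub-Gaussian bound.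
  calc _ ≤ ∫⁻ q, ENNReal.ofReal (Real.exp ((l / √d * inner ℝ s.1 q.1) ^ 2)) ∂uniformSphere d := by
        refine lintegral_mono fun q => ?_
        refine le_trans (le_of_eq ?_)
          ((lintegral_exp_inner_le hd t (l * inner ℝ s.1 q.1)).trans_eq ?_)
        · refine lintegral_congr fun r => ?_
          rw [real_inner_comm t.1 r.1, mul_assoc]
        · rw [mul_pow, mul_pow, hsq]
          congr 2
          ring
    _ ≤ ENNReal.ofReal (Real.exp (4 * (l / √d) ^ 2 / d)) := by
        refine lintegral_exp_inner_sq_le hd s ?_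
        rw [hsq, mul_div_assoc', div_le_iff₀ (by linarith)]
        linarith
    _ = _ := by
        rw [hsq]
        congr 2
        field_simp

/-! ### Independence and the noise in a query score -/

section

variable {V Ω : Type*} [MeasurableSpace Ω] {d k : ℕ}

/-- The `2k` independent coordinates regroup into `k` independent pairs, over which the integral
factorizes. -/
lemma lintegral_pi_sum_prod {α : Type*} [MeasurableSpace α] (μ : Measure α)
    [IsProbabilityMeasure μ] {h : α × α → ENNReal} (hh : Measurable h) :
    ∫⁻ c : Fin k ⊕ Fin k → α, ∏ i, h (c (.inl i), c (.inr i)) ∂Measure.pi (fun _ => μ) =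
      (∫⁻ p, h p ∂μ.prod μ) ^ k := by
  have h1 := measurePreserving_sumPiEquivProdPi (ι := Fin k) (ι' := Fin k)
    (X := fun _ => α) (fun _ => μ)
  have h2 := (measurePreserving_arrowProdEquivProdArrow α α (Fin k)
    (fun _ => μ) (fun _ => μ)).symm
  have h3 := h2.comp h1
  have h4 : ∀ i, ∫⁻ p : Fin k → α × α, h (p i) ∂Measure.pi (fun _ => μ.prod μ) =
      ∫⁻ p, h p ∂μ.prod μ := fun i =>
    (measurePreserving_eval (fun _ => μ.prod μ) i).lintegral_comp hh
  have h5 : ∫⁻ p : Fin k → α × α, ∏ i, h (p i) ∂Measure.pi (fun _ => μ.prod μ) =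
      ∏ i : Fin k, ∫⁻ p : Fin k → α × α, h (p i) ∂Measure.pi (fun _ => μ.prod μ) :=
    lintegral_prod_eq_prod_lintegral_of_indepFun _ (fun i (p : Fin k → α × α) => h (p i))
      (iIndepFun_pi (X := fun _ => h) (fun _ => hh.aemeasurable)) (fun i => by fun_prop)
  simp_rw [h4, Finset.prod_const, Finset.card_univ, Fintype.card_fin] at h5
  rw [← h5]
  exact h3.lintegral_comp (f := fun p => ∏ i, h (p i)) (by fun_prop)

lemma lintegral_pi_exp_sum_le (hd : 2 ≤ d) (s t : UnitSphere d) {l : ℝ}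
    (hl : 8 * l ^ 2 ≤ (d : ℝ) ^ 2) :
    ∫⁻ c : Fin k ⊕ Fin k → UnitSphere d,
        ENNReal.ofReal (Real.exp (l * ∑ i, inner ℝ s.1 (c (.inl i)).1 * inner ℝ (c (.inr i)).1 t.1))
        ∂Measure.pi (fun _ => uniformSphere d) ≤
      ENNReal.ofReal (Real.exp (4 * l ^ 2 / (d : ℝ) ^ 2 * k)) := by
  have : NeZero d := ⟨by omega⟩
  simp_rw [Finset.mul_sum, Real.exp_sum,
    ENNReal.ofReal_prod_of_nonneg (fun i _ => (Real.exp_pos _).le)]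
  rw [lintegral_pi_sum_prod (uniformSphere d)
    (h := fun p => ENNReal.ofReal (Real.exp (l * (inner ℝ s.1 p.1.1 * inner ℝ p.2.1 t.1))))
    (by fun_prop), mul_comm _ (k : ℝ), Real.exp_nat_mul, ENNReal.ofReal_pow (Real.exp_pos _).le]
  gcongr
  exact lintegral_exp_inner_mul_inner_le hd s t hl

lemma IsSphericalCode.map_comp_eq_pi [NeZero d] {x : V → Ω → UnitSphere d} {P : Measure Ω}
    (hx : IsSphericalCode x P) {ι : Type*} [Fintype ι] {w : ι → V} (hw : w.Injective) :
    P.map (fun ω i => x (w i) ω) = Measure.pi fun _ => uniformSphere d := by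
  rw [iIndepFun.map_fun_eq_pi_map (fun i => (hx.hasLaw (w i)).aemeasurable) (hx.indep.precomp hw)]
  congr with i : 1
  exact (hx.hasLaw (w i)).map_eq

lemma IsSphericalCode.aemeasurable_comp {x : V → Ω → UnitSphere d} {P : Measure Ω}
    (hx : IsSphericalCode x P) {ι : Type*} [Countable ι] (w : ι → V) :
    AEMeasurable (fun ω i => x (w i) ω) P :=
  aemeasurable_pi_lambda _ fun i => (hx.hasLaw (w i)).aemeasurable

/-- The families `w` and `z` may have repetitions, so independence is applied to their disjoint
images. This permits a spurious edge that is a loop. -/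
lemma IsSphericalCode.indepFun_comp {x : V → Ω → UnitSphere d} {P : Measure Ω}
    (hx : IsSphericalCode x P) {ι κ : Type*} [Finite ι] [Finite κ] {w : ι → V} {z : κ → V}
    (h : ∀ i j, w i ≠ z j) : IndepFun (fun ω i => x (w i) ω) (fun ω j => x (z j) ω) P := by
  classical
  have := Fintype.ofFinite ι
  have := Fintype.ofFinite κ
  have hdisj : Disjoint (Finset.univ.image w) (Finset.univ.image z) := by
    rw [Finset.disjoint_left]
    simp only [Finset.mem_image, Finset.mem_univ, true_and]
    rintro _ ⟨i, rfl⟩ ⟨j, hj⟩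
    exact h i j hj.symm
  have hi := hx.indep.indepFun_finset₀ _ _ hdisj fun i => (hx.hasLaw i).aemeasurable
  exact hi.comp
    (φ := fun c i => c ⟨w i, Finset.mem_image_of_mem _ (Finset.mem_univ i)⟩)
    (ψ := fun c j => c ⟨z j, Finset.mem_image_of_mem _ (Finset.mem_univ j)⟩)
    (by fun_prop) (by fun_prop)

/-- Bounding an expectation by conditioning on an independent variable. -/
lemma lintegral_le_of_indepFun {α β : Type*} [MeasurableSpace α] [MeasurableSpace β]
    {P : Measure Ω} [IsProbabilityMeasure P] {X : Ω → α} {Y : Ω → β} (hX : AEMeasurable X P)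
    (hY : AEMeasurable Y P) (h : IndepFun X Y P) {f : α → β → ENNReal}
    (hf : Measurable (Function.uncurry f)) {B : ENNReal}
    (hB : ∀ a, ∫⁻ b, f a b ∂P.map Y ≤ B) : ∫⁻ ω, f (X ω) (Y ω) ∂P ≤ B := by
  have := Measure.isProbabilityMeasure_map hX
  have := Measure.isProbabilityMeasure_map hY
  calc ∫⁻ ω, f (X ω) (Y ω) ∂P
      = ∫⁻ p, Function.uncurry f p ∂P.map (fun ω => (X ω, Y ω)) :=
        (lintegral_map' hf.aemeasurable (hX.prodMk hY)).symm
    _ = ∫⁻ a, ∫⁻ b, f a b ∂P.map Y ∂P.map X := by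
        rw [h.map_prod_eq_prod_map_map hX hY, lintegral_prod _ hf.aemeasurable]
        rfl
    _ ≤ ∫⁻ _, B ∂P.map X := lintegral_mono hB
    _ = B := by simp

/-- The exponential moments of the noise in a query score. -/
lemma IsSphericalCode.lintegral_exp_sum_le (hd : 2 ≤ d) {x : V → Ω → UnitSphere d} {P : Measure Ω}
    [IsProbabilityMeasure P] (hx : IsSphericalCode x P) {s t : V} {q r : Fin k → V}
    (hqr : (Sum.elim q r).Injective) (hs : ∀ i, s ≠ Sum.elim q r i) (ht : ∀ i, t ≠ Sum.elim q r i)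
    {l : ℝ} (hl : 8 * l ^ 2 ≤ (d : ℝ) ^ 2) :
    ∫⁻ ω, ENNReal.ofReal (Real.exp (l * ∑ i, inner ℝ (x s ω).1 (x (q i) ω).1 *
      inner ℝ (x (r i) ω).1 (x t ω).1)) ∂P ≤
      ENNReal.ofReal (Real.exp (4 * l ^ 2 / (d : ℝ) ^ 2 * k)) := by
  have : NeZero d := ⟨by omega⟩
  refine lintegral_le_of_indepFun (hx.aemeasurable_comp ![s, t])
    (hx.aemeasurable_comp (Sum.elim q r))
    (hx.indepFun_comp (by intro i j; fin_cases i; exacts [hs j, ht j]))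
    (f := fun a b => ENNReal.ofReal (Real.exp (l * ∑ i, inner ℝ (a 0).1 (b (.inl i)).1 *
      inner ℝ (b (.inr i)).1 (a 1).1))) (by fun_prop) fun a => ?_
  rw [hx.map_comp_eq_pi hqr]
  exact lintegral_pi_exp_sum_le hd _ _ hl

lemma IsSphericalCode.lintegral_exp_inner_le (hd : 2 ≤ d) {x : V → Ω → UnitSphere d} {P : Measure Ω}
    [IsProbabilityMeasure P] (hx : IsSphericalCode x P) {s t : V} (hst : s ≠ t) (l : ℝ) :
    ∫⁻ ω, ENNReal.ofReal (Real.exp (l * inner ℝ (x s ω).1 (x t ω).1)) ∂P ≤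
      ENNReal.ofReal (Real.exp (l ^ 2 / d)) := by
  refine lintegral_le_of_indepFun (hx.hasLaw s).aemeasurable (hx.hasLaw t).aemeasurable
    (hx.indep.indepFun hst)
    (f := fun a b => ENNReal.ofReal (Real.exp (l * inner ℝ a.1 b.1))) (by fun_prop) fun a => ?_
  rw [(hx.hasLaw t).map_eq]
  exact _root_.lintegral_exp_inner_le hd a l

/-- The Chernoff bound. -/
lemma measureReal_ge_le_of_lintegral_exp_le {P : Measure Ω} [IsProbabilityMeasure P] {X : Ω → ℝ}
    (hX : AEMeasurable X P) {l y B : ℝ} (hl : 0 ≤ l)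
    (h : ∫⁻ ω, ENNReal.ofReal (Real.exp (l * X ω)) ∂P ≤ ENNReal.ofReal (Real.exp B)) :
    P.real {ω | y ≤ X ω} ≤ Real.exp (B - l * y) := by
  have h1 : ENNReal.ofReal (Real.exp (l * y)) * P {ω | y ≤ X ω} ≤ ENNReal.ofReal (Real.exp B) := by
    refine le_trans ?_ ((mul_meas_ge_le_lintegral₀ (by fun_prop)
      (ENNReal.ofReal (Real.exp (l * y)))).trans h)
    refine mul_le_mul_right (measure_mono fun ω (hω : y ≤ X ω) => ?_) _
    exact ENNReal.ofReal_le_ofReal (Real.exp_le_exp.2 (mul_le_mul_of_nonneg_left hω hl))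
  have h2 := ENNReal.toReal_mono ENNReal.ofReal_ne_top h1
  rw [ENNReal.toReal_mul, ENNReal.toReal_ofReal (Real.exp_pos _).le,
    ENNReal.toReal_ofReal (Real.exp_pos _).le] at h2
  rw [Real.exp_sub, le_div_iff₀ (Real.exp_pos _), mul_comm]
  exact h2

end

/-! ### Sign symmetries and the bound `3 / 4` -/

open scoped Pointwise in
-- The surface measure of a set is proportional to the volume of the cone over it, and Lebesgue
-- measure is invariant under negation.
lemma measurePreserving_neg_uniformSphere (d : ℕ) :
    MeasurePreserving (fun q : UnitSphere d => -q) (uniformSphere d) (uniformSphere d) := by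
  refine MeasurePreserving.smul_measure ⟨measurable_neg, ?_⟩ _
  ext s hs
  have hs' : MeasurableSet ((fun q : UnitSphere d => -q) ⁻¹' s) := measurable_neg hs
  rw [Measure.map_apply measurable_neg hs, Measure.toSphere_apply' _ hs,
    Measure.toSphere_apply' _ hs', ← Measure.measure_neg volume (Set.Ioo (0 : ℝ) 1 • _)]
  congr 2
  ext y
  simp only [Set.mem_neg, Set.mem_smul, Set.mem_image, Set.mem_preimage]
  constructor
  · rintro ⟨r, hr, _, ⟨q, hq, rfl⟩, h⟩
    exact ⟨r, hr, _, ⟨-q, hq, rfl⟩, by simp [h]⟩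
  · rintro ⟨r, hr, _, ⟨q, hq, rfl⟩, h⟩
    exact ⟨r, hr, _, ⟨-q, by simpa using hq, rfl⟩, by simp [h]⟩

lemma queryScore_graphEmbedding {V : Type*} {d k : ℕ} (c : V → UnitSphere d) (u v : V)
    (q r : Fin k → V) (s t : UnitSphere d) :
    queryScore (graphEmbedding c u v q r) s t =
      inner ℝ s.1 (c u).1 * inner ℝ (c v).1 t.1 +
        ∑ i, inner ℝ s.1 (c (q i)).1 * inner ℝ (c (r i)).1 t.1 := by
  have h : ∀ y z : UnitSphere d, s.1.ofLp ⬝ᵥ (edgeEmbedding y z).mulVec t.1.ofLp =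
      inner ℝ s.1 y.1 * inner ℝ z.1 t.1 := by
    intro y z
    rw [edgeEmbedding, Matrix.vecMulVec_mulVec, EuclideanSpace.inner_eq_star_dotProduct,
      EuclideanSpace.inner_eq_star_dotProduct, dotProduct_comm t.1.ofLp, dotProduct_comm y.1.ofLp]
    simp [dotProduct_smul, mul_comm]
  simp only [queryScore, graphEmbedding, Matrix.add_mulVec, Matrix.sum_mulVec, dotProduct_add,
    dotProduct_sum, h]

lemma inner_self_unitSphere {d : ℕ} (u : UnitSphere d) : inner ℝ u.1 u.1 = (1 : ℝ) := by
  rw [real_inner_self_eq_norm_sq]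
  simp

lemma abs_inner_unitSphere_le {d : ℕ} (u v : UnitSphere d) : |inner ℝ u.1 v.1| ≤ (1 : ℝ) := by
  simpa using abs_real_inner_le_norm u.1 v.1

/-- Change the signs of the codes of the vertices in `A`. -/
noncomputable def flipSigns {V : Type*} {d : ℕ} (A : Set V) (c : V → UnitSphere d) (w : V) : UnitSphere d :=
  open Classical in if w ∈ A then -c w else c w

lemma flipSigns_of_mem {V : Type*} {d : ℕ} {A : Set V} {w : V} (h : w ∈ A)
    (c : V → UnitSphere d) : flipSigns A c w = -c w := if_pos h

lemma flipSigns_of_notMem {V : Type*} {d : ℕ} {A : Set V} {w : V} (h : w ∉ A)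
    (c : V → UnitSphere d) : flipSigns A c w = c w := if_neg h

lemma measurePreserving_flipSigns {V : Type*} [Fintype V] {d : ℕ} [NeZero d] (A : Set V) :
    MeasurePreserving (flipSigns A) (Measure.pi fun _ : V => uniformSphere d)
      (Measure.pi fun _ : V => uniformSphere d) := by
  refine measurePreserving_pi (fun _ : V => uniformSphere d) (fun _ => uniformSphere d)
    (f := fun w (y : UnitSphere d) => open Classical in if w ∈ A then -y else y) fun w => ?_
  by_cases h : w ∈ A
  · simpa [h] using measurePreserving_neg_uniformSphere d
  · simp only [h, if_false]
    exact MeasurePreserving.id (uniformSphere d)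

/-- A symmetry that changes the sign of `f` shows that `f ≤ 0` has conditional probability at
least one half. -/
lemma measureReal_le_two_mul_of_neg {α : Type*} [MeasurableSpace α] {μ : Measure α}
    [IsProbabilityMeasure μ] {g : α → α} (hg : MeasurePreserving g μ μ) {f : α → ℝ}
    (hf : Measurable f) (hfg : ∀ c, f (g c) = -f c) {E : Set α} (hE : MeasurableSet E)
    (hEg : g ⁻¹' E = E) : μ.real E ≤ 2 * μ.real (E ∩ {c | f c ≤ 0}) := by
  have hm : MeasurableSet (E ∩ {c | f c ≤ 0}) := hE.inter (measurableSet_le hf measurable_const)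
  have h1 : μ.real (E ∩ {c | 0 ≤ f c}) = μ.real (E ∩ {c | f c ≤ 0}) := by
    rw [← hg.measureReal_preimage hm.nullMeasurableSet, Set.preimage_inter, hEg]
    congr 2
    ext c
    simp [hfg]
  calc μ.real E ≤ μ.real ((E ∩ {c | 0 ≤ f c}) ∪ (E ∩ {c | f c ≤ 0})) := by
        refine measureReal_mono fun c hc => ?_
        rcases le_total 0 (f c) with h | h
        exacts [Or.inl ⟨hc, h⟩, Or.inr ⟨hc, h⟩]
    _ ≤ _ := measureReal_union_le _ _
    _ = _ := by rw [h1, two_mul]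

section

variable {V Ω : Type*} [MeasurableSpace Ω] {d k : ℕ}

/-- The bound for a spurious edge by symmetry, when there are finitely many vertices. -/
lemma pi_measureReal_queryScore_le [Fintype V] [NeZero d] {u v a b : V} {q r : Fin k → V}
    (huv : u ≠ v) (hau : a ≠ u) (hbu : b ≠ u) (hq : ∀ w, w ∈ ({u, v, a, b} : Set V) ∨ w ∈ Set.range r →
      w ∉ Set.range q) :
    (Measure.pi fun _ : V => uniformSphere d).real
      {c | queryScore (graphEmbedding c u v q r) (c u) (c v) ≤
        queryScore (graphEmbedding c u v q r) (c a) (c b)} ≤ 3 / 4 := by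
  set μ := Measure.pi fun _ : V => uniformSphere d
  set N : (V → UnitSphere d) → ℝ := fun c => inner ℝ (c a).1 (c u).1 * inner ℝ (c v).1 (c b).1 with hN
  set S : (V → UnitSphere d) → ℝ := fun c =>
    ∑ i, inner ℝ (c a).1 (c (q i)).1 * inner ℝ (c (r i)).1 (c b).1 -
      ∑ i, inner ℝ (c u).1 (c (q i)).1 * inner ℝ (c (r i)).1 (c v).1 with hS
  have hNm : Measurable N := by fun_prop
  have hSm : Measurable S := by fun_prop
  have hNE : MeasurableSet {c | N c ≤ 0} := measurableSet_le hNm measurable_const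
  have fN : ∀ c, N (flipSigns {u} c) = -N c := by
    intro c
    simp only [hN]
    rw [flipSigns_of_mem (Set.mem_singleton u), flipSigns_of_notMem (w := v) (by simpa using huv.symm),
      flipSigns_of_notMem (w := a) (by simpa using hau), flipSigns_of_notMem (w := b) (by simpa using hbu)]
    simp
  have hu := hq u (by simp)
  have hv := hq v (by simp)
  have ha := hq a (by simp)
  have hb := hq b (by simp)
  have hr := fun i => hq (r i) (by simp)
  have hqm : ∀ i, q i ∈ Set.range q := fun i => ⟨i, rfl⟩
  have gN : ∀ c, N (flipSigns (Set.range q) c) = N c := by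
    intro c
    simp only [hN, flipSigns_of_notMem hu, flipSigns_of_notMem hv, flipSigns_of_notMem ha,
      flipSigns_of_notMem hb]
  have gS : ∀ c, S (flipSigns (Set.range q) c) = -S c := by
    intro c
    simp only [hS, flipSigns_of_notMem hu, flipSigns_of_notMem hv, flipSigns_of_notMem ha,
      flipSigns_of_notMem hb, flipSigns_of_notMem (hr _), flipSigns_of_mem (hqm _)]
    simp
    ring
  -- Flipping `u` negates `N`, so `N ≤ 0` has probability at least `1/2`. Flipping all `q i` fixes
  -- `N` and negates `S`, so `N ≤ 0` and `S ≤ 0` hold together with probability at least `1/4`.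
  -- There `F - T = N + S - 1 < 0`.
  have h1 := measureReal_le_two_mul_of_neg (μ := μ) (measurePreserving_flipSigns {u}) hNm fN
    MeasurableSet.univ rfl
  have h2 := measureReal_le_two_mul_of_neg (μ := μ) (measurePreserving_flipSigns (Set.range q))
    hSm gS hNE (by ext c; simp [gN])
  rw [Set.univ_inter, probReal_univ] at h1
  have hm : MeasurableSet ({c | N c ≤ 0} ∩ {c | S c ≤ 0}) :=
    hNE.inter (measurableSet_le hSm measurable_const)
  calc _ ≤ μ.real ({c | N c ≤ 0} ∩ {c | S c ≤ 0})ᶜ := by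
        refine measureReal_mono fun c hc => ?_
        rintro ⟨hn, hs⟩
        have hn' : N c ≤ 0 := hn
        have hs' : S c ≤ 0 := hs
        simp only [Set.mem_ofPred_eq, queryScore_graphEmbedding, inner_self_unitSphere] at hc
        simp only [hN] at hn'
        simp only [hS] at hs'
        linarith
    _ = 1 - μ.real ({c | N c ≤ 0} ∩ {c | S c ≤ 0}) := probReal_compl_eq_one_sub hm
    _ ≤ 3 / 4 := by linarith

lemma measurable_queryScore_graphEmbedding [Countable V] (u v : V) (q r : Fin k → V) (s t : V) :
    Measurable fun c : V → UnitSphere d => queryScore (graphEmbedding c u v q r) (c s) (c t) := by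
  simp only [queryScore_graphEmbedding]
  fun_prop

/-- A spurious edge beats the signal edge with probability at most `3 / 4`. -/
lemma IsSphericalCode.measureReal_queryScore_le_three_quarters [NeZero d] {x : V → Ω → UnitSphere d}
    {P : Measure Ω} (hx : IsSphericalCode x P) {u v a b : V}
    {q r : Fin k → V} (huv : u ≠ v) (hau : a ≠ u) (hbu : b ≠ u)
    (hq : ∀ w, w ∈ ({u, v, a, b} : Set V) ∨ w ∈ Set.range r → w ∉ Set.range q) :
    P.real {ω | queryScore (graphEmbedding (fun w => x w ω) u v q r) (x u ω) (x v ω) ≤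
      queryScore (graphEmbedding (fun w => x w ω) u v q r) (x a ω) (x b ω)} ≤ 3 / 4 := by
  -- `V` may be infinite; only these finitely many vertices matter, and their codes have a product
  -- law.
  set A : Set V := {u, v, a, b} ∪ (Set.range q ∪ Set.range r)
  have hA : A.Finite := (Set.toFinite _).union ((Set.finite_range q).union (Set.finite_range r))
  have := hA.fintype
  have mem : ∀ w, w ∈ ({u, v, a, b} : Set V) → w ∈ A := fun w hw => Or.inl hw
  have h := pi_measureReal_queryScore_le (V := A) (d := d) (u := ⟨u, mem u (by simp)⟩)
    (v := ⟨v, mem v (by simp)⟩) (a := ⟨a, mem a (by simp)⟩) (b := ⟨b, mem b (by simp)⟩)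
    (q := fun i => ⟨q i, Or.inr (Or.inl ⟨i, rfl⟩)⟩) (r := fun i => ⟨r i, Or.inr (Or.inr ⟨i, rfl⟩)⟩)
    (by simpa using huv) (by simpa using hau) (by simpa using hbu) (by
      rintro ⟨w, hw⟩ h ⟨i, hi⟩
      refine hq w ?_ ⟨i, congrArg Subtype.val hi⟩
      rcases h with h | ⟨j, hj⟩
      · exact Or.inl (by simpa using h)
      · exact Or.inr ⟨j, congrArg Subtype.val hj⟩)
  rw [← hx.map_comp_eq_pi (w := ((↑) : A → V)) Subtype.val_injective,
    map_measureReal_apply_of_aemeasurable (hx.aemeasurable_comp _)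
      (measurableSet_le (measurable_queryScore_graphEmbedding ..)
        (measurable_queryScore_graphEmbedding ..))] at h
  exact h

/-! ### Tail bounds and removal of the constant factor -/

/-- The exponential bound for a spurious edge. -/
lemma IsSphericalCode.measureReal_queryScore_le_exp (hd : 2 ≤ d) (hdk : d ≤ k)
    {x : V → Ω → UnitSphere d} {P : Measure Ω} [IsProbabilityMeasure P] (hx : IsSphericalCode x P)
    {u v a b : V} {q r : Fin k → V} (hau : a ≠ u) (hqr : (Sum.elim q r).Injective)
    (hu : ∀ i, u ≠ Sum.elim q r i) (hv : ∀ i, v ≠ Sum.elim q r i)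
    (ha : ∀ i, a ≠ Sum.elim q r i) (hb : ∀ i, b ≠ Sum.elim q r i) :
    P.real {ω | queryScore (graphEmbedding (fun w => x w ω) u v q r) (x u ω) (x v ω) ≤
      queryScore (graphEmbedding (fun w => x w ω) u v q r) (x a ω) (x b ω)} ≤
      4 * Real.exp (-((d : ℝ) ^ 2 / k / 256)) := by
  have hd' : (2 : ℝ) ≤ d := by exact_mod_cast hd
  have hdk' : (d : ℝ) ≤ k := by exact_mod_cast hdk
  have hk : (0 : ℝ) < k := by linarith
  have hm : ∀ w, AEMeasurable (x w) P := fun w => (hx.hasLaw w).aemeasurable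
  set N : Ω → ℝ := fun ω => inner ℝ (x a ω).1 (x u ω).1 with hN
  set S : V → V → Ω → ℝ := fun s t ω =>
    ∑ i, inner ℝ (x s ω).1 (x (q i) ω).1 * inner ℝ (x (r i) ω).1 (x t ω).1 with hS
  have hNm : AEMeasurable N P := by fun_prop
  have hSm : ∀ s t, AEMeasurable (S s t) P := fun s t => by fun_prop
  set y : ℝ := (d : ℝ) ^ 2 / k with hy
  have hy0 : 0 ≤ y := by positivity
  have hyd : y ≤ d := by rw [hy, div_le_iff₀ hk]; nlinarith
  -- The Chernoff parameter for the sums is `y / 32`: the moment exponent is `y/256` and the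
  -- threshold `1/4` subtracts `y/128`, leaving `-y/256`.
  have hl : 8 * (y / 32) ^ 2 ≤ (d : ℝ) ^ 2 := by nlinarith
  have hl' : 8 * (-(y / 32)) ^ 2 ≤ (d : ℝ) ^ 2 := by nlinarith
  have hB : 4 * (y / 32) ^ 2 / (d : ℝ) ^ 2 * k = y / 256 := by
    rw [hy]
    field_simp
    norm_num
  -- Here `l = d/4` gives the exponent `d/16 - d/8 = -d/16`, which is at most `-y/256` as `y ≤ d`.
  have e1 : P.real {ω | 1 / 2 ≤ N ω} ≤ Real.exp (-(y / 256)) := by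
    refine (measureReal_ge_le_of_lintegral_exp_le hNm (l := d / 4) (by positivity)
      (hx.lintegral_exp_inner_le hd hau _)).trans (Real.exp_le_exp.2 ?_)
    have : (d / 4 : ℝ) ^ 2 / d = d / 16 := by field_simp; norm_num
    linarith
  have e2 : P.real {ω | 1 / 2 ≤ -N ω} ≤ Real.exp (-(y / 256)) := by
    refine (measureReal_ge_le_of_lintegral_exp_le hNm.neg (l := d / 4) (B := (-(d / 4)) ^ 2 / d)
      (by positivity) ?_).trans (Real.exp_le_exp.2 ?_)
    · simp only [Pi.neg_apply, mul_neg, ← neg_mul]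
      exact hx.lintegral_exp_inner_le hd hau _
    · have : (-(d / 4 : ℝ)) ^ 2 / d = d / 16 := by field_simp; norm_num
      linarith
  have e3 : P.real {ω | 1 / 4 ≤ -S u v ω} ≤ Real.exp (-(y / 256)) := by
    refine (measureReal_ge_le_of_lintegral_exp_le (hSm u v).neg (l := y / 32)
      (B := 4 * (-(y / 32)) ^ 2 / (d : ℝ) ^ 2 * k) (by positivity) ?_).trans (Real.exp_le_exp.2 ?_)
    · simp only [Pi.neg_apply, mul_neg, ← neg_mul]
      exact hx.lintegral_exp_sum_le hd hqr hu hv hl'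
    · rw [neg_sq, hB]
      linarith
  have e4 : P.real {ω | 1 / 4 ≤ S a b ω} ≤ Real.exp (-(y / 256)) := by
    refine (measureReal_ge_le_of_lintegral_exp_le (hSm a b) (l := y / 32) (by positivity)
      (hx.lintegral_exp_sum_le hd hqr ha hb hl)).trans (Real.exp_le_exp.2 ?_)
    rw [hB]
    linarith
  -- The margin `1` is split as `1/2 + 1/4 + 1/4`. The factor `⟨v, b⟩` is only bounded by `1`, so `b
  -- = v` needs no exclusion.
  calc _ ≤ P.real (({ω | 1 / 2 ≤ N ω} ∪ {ω | 1 / 2 ≤ -N ω}) ∪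
        ({ω | 1 / 4 ≤ -S u v ω} ∪ {ω | 1 / 4 ≤ S a b ω})) := by
        refine measureReal_mono fun ω hω => ?_
        by_contra hcon
        simp only [Set.mem_union, Set.mem_ofPred_eq, not_or, not_le] at hcon
        obtain ⟨⟨h1, h2⟩, h3, h4⟩ := hcon
        simp only [Set.mem_ofPred_eq, queryScore_graphEmbedding, inner_self_unitSphere] at hω
        have h5 : inner ℝ (x a ω).1 (x u ω).1 * inner ℝ (x v ω).1 (x b ω).1 ≤ (1 / 2 : ℝ) := by
          refine (le_abs_self _).trans ?_
          rw [abs_mul]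
          have h6 : |inner ℝ (x a ω).1 (x u ω).1| ≤ (1 / 2 : ℝ) := abs_le.2 ⟨by linarith, h1.le⟩
          have := mul_le_mul h6 (abs_inner_unitSphere_le (x v ω) (x b ω)) (abs_nonneg _) (by norm_num)
          linarith
        simp only [hS] at h3 h4
        linarith
    _ ≤ (P.real {ω | 1 / 2 ≤ N ω} + P.real {ω | 1 / 2 ≤ -N ω}) +
        (P.real {ω | 1 / 4 ≤ -S u v ω} + P.real {ω | 1 / 4 ≤ S a b ω}) :=
        (measureReal_union_le _ _).trans
          (add_le_add (measureReal_union_le _ _) (measureReal_union_le _ _))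
    _ ≤ _ := by linarith

/-- A bound by a constant below `1` absorbs the constant in front of an exponential bound. -/
lemma le_exp_of_le_three_quarters {p y : ℝ} (hy : 0 ≤ y) (h1 : p ≤ 3 / 4)
    (h2 : 1 < y → p ≤ 4 * Real.exp (-(y / 256))) : p ≤ Real.exp (-(y / 4096)) := by
  set z := Real.exp (-(y / 4096)) with hz
  have hz0 : 0 < z := Real.exp_pos _
  have hz1 : z ≤ 1 := Real.exp_le_one_iff.2 (by linarith)
  have h16 : Real.exp (-(y / 256)) = z ^ 16 := by
    rw [hz, ← Real.exp_nat_mul]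
    congr 1
    push_cast
    ring
  -- If `z ≥ 3/4` the constant bound suffices. Otherwise `y > 1`, and `4 z ^ 16 ≤ z` because `4
  -- (3/4) ^ 15 ≤ 1`.
  rcases le_or_gt (3 / 4) z with h | h
  · exact h1.trans h
  · have hy1 : 1 < y := by
      by_contra hcon
      have := Real.add_one_le_exp (-(y / 4096))
      linarith
    refine (h2 hy1).trans ?_
    rw [h16]
    have h15 : z ^ 15 ≤ (3 / 4) ^ 15 := by gcongr
    have : 4 * z ^ 16 = z * (4 * z ^ 15) := by ring
    rw [this]
    have h4 : 4 * z ^ 15 ≤ 1 := by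
      norm_num at h15 ⊢
      linarith
    nlinarith

end

theorem mainTheorem5 :
    ∃ C : ℝ, 0 < C ∧ ∀ (d k M : ℕ), 1 ≤ d → d ≤ k →
      ∀ (V Ω : Type*) [MeasurableSpace Ω] (P : Measure Ω) [IsProbabilityMeasure P]
        (x : V → Ω → UnitSphere d), IsSphericalCode x P →
      ∀ (u v : V) (q r : Fin k → V), Function.Injective (graphVertices u v q r) →
      ∀ (a b : Fin M → V),
        (∀ j, a j ∉ Set.range (graphVertices u v q r)) →
        (∀ j, b j ∉ Set.range (graphVertices u v q r)) →
        1 - (M : ℝ) * Real.exp (-(C * (d : ℝ) ^ 2 / (k : ℝ))) ≤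
          P.real (correctRecovery x u v q r a b) := by
  -- `4096 = 16 * 256`: the Chernoff rate `1/256` is reduced sixteenfold to absorb the factor `4`.
  refine ⟨1 / 4096, by norm_num, ?_⟩
  intro d k M hd hdk V Ω _ P _ x hx u v q r hinj a b ha hb
  have : NeZero d := ⟨by omega⟩
  have hk : 1 ≤ k := hd.trans hdk
  have hdR : (1 : ℝ) ≤ d := by exact_mod_cast hd
  have hkR : (1 : ℝ) ≤ k := by exact_mod_cast hk
  have hqr : (Sum.elim q r).Injective := fun i j h => Sum.inr_injective (hinj (a₁ := .inr i) (a₂ := .inr j) h)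
  have huv : u ≠ v := fun h => by simpa using hinj (a₁ := .inl 0) (a₂ := .inl 1) h
  have hu : ∀ i, u ≠ Sum.elim q r i := fun i h => by simpa using hinj (a₁ := .inl 0) (a₂ := .inr i) h
  have hv : ∀ i, v ≠ Sum.elim q r i := fun i h => by simpa using hinj (a₁ := .inl 1) (a₂ := .inr i) h
  have bad : ∀ j, P.real {ω | queryScore (graphEmbedding (fun w => x w ω) u v q r) (x u ω) (x v ω) ≤
      queryScore (graphEmbedding (fun w => x w ω) u v q r) (x (a j) ω) (x (b j) ω)} ≤
      Real.exp (-((d : ℝ) ^ 2 / k / 4096)) := by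
    intro j
    have hau : a j ≠ u := fun h => ha j ⟨.inl 0, h.symm⟩
    have hbu : b j ≠ u := fun h => hb j ⟨.inl 0, h.symm⟩
    have ha' : ∀ i, a j ≠ Sum.elim q r i := fun i h => ha j ⟨.inr i, h.symm⟩
    have hb' : ∀ i, b j ≠ Sum.elim q r i := fun i h => hb j ⟨.inr i, h.symm⟩
    refine le_exp_of_le_three_quarters (by positivity) ?_ fun hy => ?_
    · refine hx.measureReal_queryScore_le_three_quarters huv hau hbu ?_
      rintro w hw ⟨i, rfl⟩
      rcases hw with (h | h | h | h) | ⟨i', h⟩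
      · exact hu (.inl i) h.symm
      · exact hv (.inl i) h.symm
      · exact ha' (.inl i) h.symm
      · exact hb' (.inl i) h.symm
      · simpa using hqr (a₁ := .inr i') (a₂ := .inl i) h
    · refine hx.measureReal_queryScore_le_exp ?_ hdk hau hqr hu hv ha' hb'
      -- The exponential bound needs `d ≥ 2`; for `d = 1` the assumption `1 < d²/k` contradicts `k ≥
      -- 1`.
      by_contra hcon
      obtain rfl : d = 1 := by omega
      rw [lt_div_iff₀ (by linarith)] at hy
      norm_num at hy
      linarith
  have hcompl : (correctRecovery x u v q r a b)ᶜ = ⋃ j,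
      {ω | queryScore (graphEmbedding (fun w => x w ω) u v q r) (x u ω) (x v ω) ≤
        queryScore (graphEmbedding (fun w => x w ω) u v q r) (x (a j) ω) (x (b j) ω)} := by
    ext ω
    simp [correctRecovery]
  have h1 : P.real (correctRecovery x u v q r a b)ᶜ ≤
      M * Real.exp (-((d : ℝ) ^ 2 / k / 4096)) := by
    rw [hcompl]
    refine (measureReal_iUnion_fintype_le _).trans ((Finset.sum_le_sum fun j _ => bad j).trans_eq ?_)
    simp
  have h2 : 1 ≤ P.real (correctRecovery x u v q r a b) +
      P.real (correctRecovery x u v q r a b)ᶜ := by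
    rw [← probReal_univ (μ := P), ← Set.union_compl_self (correctRecovery x u v q r a b)]
    exact measureReal_union_le _ _
  have h3 : 1 / 4096 * (d : ℝ) ^ 2 / k = (d : ℝ) ^ 2 / k / 4096 := by ring
  rw [h3]
  linarith
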